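/- Let $\Theta\subset\mathbb R^p$ and $\Xi\subset\mathbb R^n$ be compact connected smooth embedded submanifolds, $\Theta$ without boundary and $\Xi$ with possibly empty boundary $\partial\Xi$, endowed with the metrics induced by the Euclidean ones. Let $f:\Theta\times\Xi\to\mathbb R$ be three times continuously differentiable on $\Theta\times\Xi$, and write $\operatorname{argmax} f(\theta,\cdot)\subset\Xi$ for the set of maximizers of $f(\theta,\cdot)$ over $\Xi$. Assume: (i) (Parametric Morse-Bott) with $\operatorname{grad}_\xi f$ and $\operatorname{Hess}_\xi f$ the Riemannian gradient and Hessian of $f(\theta,\cdot)$ on $\Xi$, the augmented critical set $$M=\{(\theta,\xi)\in\Theta\times\Xi:\ \operatorname{grad}_\xi f(\theta,\xi)=0\}$$ is a smooth embedded submanifold of $\Theta\times(\Xi\setminus\partial\Xi)$ whose dimension at each $(\theta,\xi)\in M$ is $\dim\Theta+\dim\ker\operatorname{Hess}_\xi f(\theta,\xi)$; (ii) for every $\theta\in\Theta$, $\operatorname{argmax} f(\theta,\cdot)\subset\Xi\setminus\partial\Xi$ (this is void if $\partial\Xi=\emptyset$); (iii) for every $\rho>0$ there is $\Delta>0$ such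 that for all $\theta\in\Theta$ and $\zeta\in\Xi$, $$\operatorname{dist}(\zeta,\operatorname{argmax} f(\theta,\cdot))\ge\rho\ \Longrightarrow\ f(\theta,\zeta)-\max_{\Xi} f(\theta,\cdot)\le-\Delta .$$ Then there exist $\mu>0$ and $L>0$ such that for all $\theta\in\Theta$, all $\xi\in\Xi$ and every Euclidean projection $\xi^*$ of $\xi$ onto $\operatorname{argmax} f(\theta,\cdot)$, i.e. $\xi^*\in\operatorname{argmin}_{\zeta\in\operatorname{argmax} f(\theta,\cdot)}\|\xi-\zeta\|$, $$f(\theta,\xi^*)\ \ge\ f(\theta,\xi)+\frac{\mu}{2}\|\xi-\xi^*\|^2-\frac{L}{6}\|\xi-\xi^*\|^3 .$$ -/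

import Mathlib

open scoped ContDiff

noncomputable section

namespace MorseBott

section Submanifolds

variable {E : Type*} [NormedAddCommGroup E] [NormedSpace ℝ E]

/-- `Φ` is a smooth (`C^∞`) diffeomorphism between the open sets `Φ.source` and `Φ.target`. -/
def IsSmoothDiffeo (Φ : OpenPartialHomeomorph E E) : Prop :=
  ContDiffOn ℝ ∞ Φ Φ.source ∧ ContDiffOn ℝ ∞ Φ.symm Φ.target

/-- Near `x`, the set `S` is a smooth embedded submanifold of dimension `d` without boundary:
an ambient diffeomorphism around `x` straightens `S` to a `d`-dimensional linear subspace. -/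
def HasSliceChart (S : Set E) (d : ℕ) (x : E) : Prop :=
  ∃ (Φ : OpenPartialHomeomorph E E) (W : Submodule ℝ E),
    IsSmoothDiffeo Φ ∧ Module.finrank ℝ W = d ∧ x ∈ Φ.source ∧
      ∀ y ∈ Φ.source, y ∈ S ↔ Φ y ∈ W

/-- Near `x`, the set `S` is a smooth embedded submanifold of dimension `d` with boundary, and `x`
is a boundary point: an ambient diffeomorphism around `x` straightens `S` to a closed half-space
`{w ∈ W | 0 ≤ ℓ w}` of a `d`-dimensional linear subspace `W`, and sends `x` to `ℓ = 0`. -/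
def HasHalfSliceChart (S : Set E) (d : ℕ) (x : E) : Prop :=
  ∃ (Φ : OpenPartialHomeomorph E E) (W : Submodule ℝ E) (ℓ : E →L[ℝ] ℝ),
    IsSmoothDiffeo Φ ∧ Module.finrank ℝ W = d ∧ (∃ w ∈ W, ℓ w ≠ 0) ∧
      x ∈ Φ.source ∧ ℓ (Φ x) = 0 ∧
      ∀ y ∈ Φ.source, y ∈ S ↔ (Φ y ∈ W ∧ 0 ≤ ℓ (Φ y))

/-- Smooth embedded submanifold of dimension `d`, without boundary. -/
def IsSubmanifold (S : Set E) (d : ℕ) : Prop :=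
  ∀ x ∈ S, HasSliceChart S d x

/-- Smooth embedded submanifold of dimension `d`, with possibly empty boundary. -/
def IsSubmanifoldWithBoundary (S : Set E) (d : ℕ) : Prop :=
  ∀ x ∈ S, HasSliceChart S d x ∨ HasHalfSliceChart S d x

/-- The manifold boundary `∂S` of a `d`-dimensional submanifold `S`. -/
def manifoldBoundary (S : Set E) (d : ℕ) : Set E :=
  {x ∈ S | HasHalfSliceChart S d x}

/-- The tangent space `T_x S`, as a linear subspace of the ambient space: the span of the tangent
directions to `S` at `x` (at a boundary point these form only a half-space of `T_x S`). -/
def tangentSpace (S : Set E) (x : E) : Submodule ℝ E :=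
  Submodule.span ℝ (tangentConeAt ℝ S x)

end Submanifolds

section Riemannian

variable {F : Type*} [NormedAddCommGroup F] [InnerProductSpace ℝ F] [FiniteDimensional ℝ F]

/-- The Riemannian gradient at `x` of `g : S → ℝ`, for the metric induced on `S` by the ambient
inner product. A derivative of `g` within `S` is determined on `T_x S` only; the orthogonal
projection removes the ambiguity. -/
def riemGrad (g : F → ℝ) (S : Set F) (x : F) : F :=
  (tangentSpace S x).starProjection (gradientWithin g S x)

/-- The Riemannian Hessian at `x` of `g : S → ℝ`, as an endomorphism of `T_x S`:
`Hess g (x) v = ∇_v grad g`, where the Levi-Civita connection of the induced metric is the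
tangential projection of the ambient derivative along `S`. -/
def riemHess (g : F → ℝ) (S : Set F) (x : F) : tangentSpace S x →ₗ[ℝ] tangentSpace S x :=
  ((tangentSpace S x).orthogonalProjectionOnto.toLinearMap ∘ₗ
    (fderivWithin ℝ (riemGrad g S) S x).toLinearMap) ∘ₗ (tangentSpace S x).subtype

end Riemannian

section Objectives

/-- The set of maximizers of `g` over `S`. -/
def argmaxOn {F : Type*} (g : F → ℝ) (S : Set F) : Set F :=
  {x ∈ S | IsMaxOn g S x}

/-- For every radius `ρ > 0` there is a margin `Δ > 0`, uniform over the class `𝓕` of functions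
on `S`, such that at distance at least `ρ` from its maximizers each function of the class is below
its maximum by at least `Δ`. -/
def UniformMargin {F : Type*} [PseudoMetricSpace F] (𝓕 : Set (F → ℝ)) (S : Set F) : Prop :=
  ∀ ρ > 0, ∃ Δ > 0, ∀ g ∈ 𝓕, ∀ ζ ∈ S,
    ρ ≤ Metric.infDist ζ (argmaxOn g S) → g ζ - sSup (g '' S) ≤ -Δ

variable {E : Type*} [NormedAddCommGroup E] [NormedSpace ℝ E]
variable {F : Type*} [NormedAddCommGroup F] [InnerProductSpace ℝ F] [FiniteDimensional ℝ F]

/-- The augmented critical set `{(θ, ξ) ∈ Θ × Ξ | grad_ξ f(θ, ξ) = 0}`. -/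
def augmentedCritical (Θ : Set E) (Ξ : Set F) (f : E → F → ℝ) : Set (E × F) :=
  {z | z.1 ∈ Θ ∧ z.2 ∈ Ξ ∧ riemGrad (f z.1) Ξ z.2 = 0}

/-- `f` is parametric Morse-Bott on `Θ × Ξ`, where `dim Θ = k` and `dim Ξ = d`: the augmented
critical set is a smooth embedded submanifold of `Θ × (Ξ \ ∂Ξ)`, of dimension
`dim Θ + dim ker Hess_ξ f(θ, ξ)` at each of its points `(θ, ξ)`. (A subset of the embedded
submanifold `Θ × (Ξ \ ∂Ξ)` is an embedded submanifold of it exactly when it is one of the ambient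
vector space.) -/
def IsParametricMorseBott (Θ : Set E) (k : ℕ) (Ξ : Set F) (d : ℕ) (f : E → F → ℝ) : Prop :=
  augmentedCritical Θ Ξ f ⊆ Θ ×ˢ (Ξ \ manifoldBoundary Ξ d) ∧
    ∀ z ∈ augmentedCritical Θ Ξ f,
      HasSliceChart (augmentedCritical Θ Ξ f)
        (k + Module.finrank ℝ (LinearMap.ker (riemHess (f z.1) Ξ z.2))) z

end Objectives

end MorseBott

end

open Filter Topology

namespace MorseBott

/-! ### Second-order calculus along lines and coercivity of semidefinite forms. -/

section Calculus

/-! The heart is local quadratic growth near a maximizer, in charts turning `Θ × Ξ` into a product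
`A × W` of vector spaces. The chart of the critical set gives an immersion `ψ : Q → A × W`. Let `K`
be the kernel of the fibre Hessian at the maximizer and `R` a complement of `K`. Differentiating the
criticality equation along `ψ` shows that vertical tangent vectors of the critical set lie in `K`;
hence `(q, r) ↦ ψ q + (0, r)`, with `r ∈ R`, has injective derivative, and the Morse-Bott dimension
makes it a local diffeomorphism. Every nearby point `(a, x)` is thus a critical point in the same
fibre plus a displacement in `R`. The Hessian is negative definite on `R`, so `g (a, ·)` drops
quadratically along that displacement. The value at the projected critical point does not depend on
`x`, because fibre derivatives vanish there; so if the fibre contains a nearby maximizer, the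
projected point is one too. This is `exists_quadratic_growth_of_fiberCritical`.

`finrank_ker_le_finrank_ker_riemHess` links the chart Hessian to the Riemannian one, and
`exists_local_quadratic_growth` carries the bound back to `Θ × Ξ`. Compactness of the set of pairs
(parameter, maximizer) gives one constant `c` and one radius `r`. Growth away from some maximizer
implies growth away from the nearest one, with the same `c`; beyond distance `r` the cubic term
absorbs the quadratic one. -/

theorem eventually_norm_sub_lt {X F' : Type*} [TopologicalSpace X] [NormedAddCommGroup F']
    {h : X → F'} {z : X} (hh : ContinuousAt h z) {ε : ℝ} (hε : 0 < ε) :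
    ∀ᶠ y in 𝓝 z, ‖h y - h z‖ < ε := by
  filter_upwards [hh (Metric.ball_mem_nhds _ hε)] with y hy
  rwa [← dist_eq_norm]

variable {G : Type*} [NormedAddCommGroup G] [NormedSpace ℝ G]

theorem le_sub_of_second_deriv_le {h h' h'' : ℝ → ℝ} {C : ℝ}
    (hh : ∀ t ∈ Set.Icc (0 : ℝ) 1, HasDerivAt h (h' t) t)
    (hh' : ∀ t ∈ Set.Icc (0 : ℝ) 1, HasDerivAt h' (h'' t) t)
    (h0 : h' 0 = 0) (hC : ∀ t ∈ Set.Icc (0 : ℝ) 1, h'' t ≤ -C) :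
    h 1 ≤ h 0 - C / 2 := by
  have h1 : ∀ t ∈ Set.Icc (0 : ℝ) 1, h' t ≤ -C * t := by
    have hd : ∀ t ∈ Set.Icc (0 : ℝ) 1,
        HasDerivAt (fun t => h' t + C * t) (h'' t + C * 1) t := fun t ht =>
      (hh' t ht).add ((hasDerivAt_id t).const_mul C)
    have hanti : AntitoneOn (fun t => h' t + C * t) (Set.Icc 0 1) := by
      refine antitoneOn_of_deriv_nonpos (convex_Icc 0 1)
        (fun t ht => (hd t ht).continuousAt.continuousWithinAt)
        (fun t ht => (hd t (interior_subset ht)).differentiableAt.differentiableWithinAt) ?_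
      intro t ht
      rw [(hd t (interior_subset ht)).deriv]
      linarith [hC t (interior_subset ht)]
    intro t ht
    have := hanti (Set.left_mem_Icc.2 zero_le_one) ht ht.1
    simp only [h0] at this
    linarith
  have hd : ∀ t ∈ Set.Icc (0 : ℝ) 1,
      HasDerivAt (fun t => h t + C / 2 * t ^ 2) (h' t + C / 2 * (2 * t)) t := fun t ht => by
    have := (hh t ht).add ((hasDerivAt_pow 2 t).const_mul (C / 2))
    simp only [Nat.cast_ofNat, Nat.add_one_sub_one, pow_one] at this
    exact this
  have hanti : AntitoneOn (fun t => h t + C / 2 * t ^ 2) (Set.Icc 0 1) := by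
    refine antitoneOn_of_deriv_nonpos (convex_Icc 0 1)
      (fun t ht => (hd t ht).continuousAt.continuousWithinAt)
      (fun t ht => (hd t (interior_subset ht)).differentiableAt.differentiableWithinAt) ?_
    intro t ht
    rw [(hd t (interior_subset ht)).deriv]
    linarith [h1 t (interior_subset ht)]
  have := hanti (Set.left_mem_Icc.2 zero_le_one) (Set.right_mem_Icc.2 zero_le_one) zero_le_one
  simp only at this
  linarith

theorem hasDerivAt_comp_line {F' : Type*} [NormedAddCommGroup F'] [NormedSpace ℝ F']
    {g : G → F'} {z v : G} {t : ℝ} (hg : DifferentiableAt ℝ g (z + t • v)) :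
    HasDerivAt (fun t : ℝ => g (z + t • v)) (fderiv ℝ g (z + t • v) v) t := by
  have hl : HasDerivAt (fun t : ℝ => z + t • v) v t := by
    simpa using ((hasDerivAt_id t).smul_const v).const_add z
  exact hg.hasFDerivAt.comp_hasDerivAt t hl

theorem differentiableAt_fderiv_of_contDiffAt {g : G → ℝ} {z : G} (hg : ContDiffAt ℝ 2 g z) :
    DifferentiableAt ℝ (fderiv ℝ g) z :=
  (hg.fderiv_right (m := 1) (by norm_num)).differentiableAt (by norm_num)

theorem hasDerivAt_fderiv_comp_line {g : G → ℝ} {z v : G} {t : ℝ}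
    (hg : ContDiffAt ℝ 2 g (z + t • v)) :
    HasDerivAt (fun t : ℝ => fderiv ℝ g (z + t • v) v)
      (fderiv ℝ (fderiv ℝ g) (z + t • v) v v) t :=
  (ContinuousLinearMap.apply ℝ ℝ v).hasFDerivAt.comp_hasDerivAt t
    (hasDerivAt_comp_line (differentiableAt_fderiv_of_contDiffAt hg))

theorem eventually_norm_fderiv_fderiv_sub_lt {g : G → ℝ} {z : G}
    (hg : ContDiffAt ℝ 2 g z) {ε : ℝ} (hε : 0 < ε) :
    ∀ᶠ y in 𝓝 z, ‖fderiv ℝ (fderiv ℝ g) y - fderiv ℝ (fderiv ℝ g) z‖ < ε :=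
  eventually_norm_sub_lt (h := fun y => fderiv ℝ (fderiv ℝ g) y)
    ((hg.fderiv_right (m := 1) (by norm_num)).fderiv_right (m := 0) (by norm_num)).continuousAt hε

/-- Second-order upper bound along a segment on which the second derivative is bounded above. -/
theorem le_sub_of_fderiv_fderiv_le {g : G → ℝ} {s : Set G} (hs : Convex ℝ s) {z v : G} {C : ℝ}
    (hg : ∀ y ∈ s, ContDiffAt ℝ 2 g y) (hz : z ∈ s) (hzv : z + v ∈ s)
    (hcrit : fderiv ℝ g z v = 0) (hC : ∀ y ∈ s, fderiv ℝ (fderiv ℝ g) y v v ≤ -C) :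
    g (z + v) ≤ g z - C / 2 := by
  have hmem : ∀ t ∈ Set.Icc (0 : ℝ) 1, z + t • v ∈ s := fun t ht =>
    hs.add_smul_mem hz hzv ht
  have := le_sub_of_second_deriv_le (h := fun t : ℝ => g (z + t • v))
    (h' := fun t : ℝ => fderiv ℝ g (z + t • v) v)
    (h'' := fun t : ℝ => fderiv ℝ (fderiv ℝ g) (z + t • v) v v) (C := C)
    (fun t ht => hasDerivAt_comp_line ((hg _ (hmem t ht)).differentiableAt (by norm_num)))
    (fun t ht => hasDerivAt_fderiv_comp_line (hg _ (hmem t ht)))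
    (by simpa using hcrit) (fun t ht => hC _ (hmem t ht))
  simpa using this

/-- Second-order necessary condition for a local maximum along a line. -/
theorem fderiv_fderiv_nonpos_of_isLocalMax {g : G → ℝ} {z v : G} (hg : ContDiffAt ℝ 2 g z)
    (hmax : IsLocalMax (fun t : ℝ => g (z + t • v)) 0) : fderiv ℝ (fderiv ℝ g) z v v ≤ 0 := by
  by_contra! hpos
  have hline : Tendsto (fun t : ℝ => z + t • v) (𝓝 0) (𝓝 z) := by
    have : Continuous (fun t : ℝ => z + t • v) := by fun_prop
    simpa using this.tendsto 0
  have hd : deriv (fun t : ℝ => g (z + t • v)) =ᶠ[𝓝 0] fun t => fderiv ℝ g (z + t • v) v := by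
    filter_upwards [hline.eventually (hg.eventually (by norm_num))] with t ht
    exact (hasDerivAt_comp_line (ht.differentiableAt (by norm_num))).deriv
  have hdd : deriv (deriv (fun t : ℝ => g (z + t • v))) 0 = fderiv ℝ (fderiv ℝ g) z v v := by
    rw [hd.deriv_eq]
    have := hasDerivAt_fderiv_comp_line (z := z) (v := v) (t := 0) (g := g) (by simpa using hg)
    simpa using this.deriv
  -- A positive second derivative would make the point a local minimum as well, so the function
  -- would be locally constant along the line and its second derivative zero.
  have hmin := isLocalMin_of_deriv_deriv_pos (f := fun t : ℝ => g (z + t • v)) (x₀ := 0)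
    (by rw [hdd]; exact hpos) hmax.deriv_eq_zero
    (by simpa [ContinuousAt, Function.comp_def] using hg.continuousAt.tendsto.comp hline)
  have hconst : (fun t : ℝ => g (z + t • v)) =ᶠ[𝓝 0] fun _ => g (z + (0 : ℝ) • v) := by
    filter_upwards [hmin, hmax] with t h1 h2 using le_antisymm h2 h1
  have : deriv (deriv (fun t : ℝ => g (z + t • v))) 0 = 0 := by
    rw [hconst.deriv.deriv_eq]; simp
  linarith

/-- A negative semidefinite symmetric form is coercive on any subspace transverse to its kernel. -/
theorem exists_coercive_of_disjoint_ker [FiniteDimensional ℝ G] (H : G →L[ℝ] G →L[ℝ] ℝ)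
    (hsymm : ∀ v w, H v w = H w v) (hneg : ∀ v, H v v ≤ 0) (R : Submodule ℝ G)
    (hR : Disjoint (LinearMap.ker H.toLinearMap) R) :
    ∃ c > 0, ∀ v ∈ R, H v v ≤ -c * ‖v‖ ^ 2 := by
  have hker : ∀ v, H v v = 0 → H v = 0 := by
    intro v hv
    ext w
    have key : ∀ t : ℝ, 2 * t * H v w + t ^ 2 * H w w ≤ 0 := by
      intro t
      have := hneg (v + t • w)
      simp only [map_add, map_smul, add_apply, smul_apply,
        smul_eq_mul, hv, hsymm w v] at this
      nlinarith
    have hw := hneg w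
    by_contra hne
    simp only [zero_apply] at hne
    -- With this `t` the quadratic in `key` equals `t² (2 - H w w)`, which is positive if `H v w ≠
    -- 0`; the `1` in the denominator covers `H w w = 0`.
    have h1 := key (H v w / (1 - H w w))
    have hpos : 0 < 1 - H w w := by linarith
    have h2 : 2 * (H v w / (1 - H w w)) * H v w + (H v w / (1 - H w w)) ^ 2 * H w w
        = (H v w / (1 - H w w)) ^ 2 * (2 - H w w) := by
      field_simp
      ring
    rw [h2] at h1
    have h3 : 0 < (H v w / (1 - H w w)) ^ 2 := by positivity
    nlinarith
  set S : Set G := (R : Set G) ∩ Metric.sphere 0 1 with hS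
  have hScomp : IsCompact S := (isCompact_sphere (0 : G) 1).inter_left R.closed_of_finiteDimensional
  have hcont : Continuous fun v => H v v := by fun_prop
  rcases S.eq_empty_or_nonempty with hemp | hne
  · refine ⟨1, one_pos, fun v hv => ?_⟩
    have : v = 0 := by
      by_contra hv0
      have : ‖v‖⁻¹ • v ∈ S := ⟨R.smul_mem _ hv, by simp [norm_smul, hv0]⟩
      simp [hemp] at this
    simp [this]
  · obtain ⟨u, hu, hmax⟩ := hScomp.exists_isMaxOn hne hcont.continuousOn
    have hu0 : u ≠ 0 := by
      rintro rfl
      simpa using hu.2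
    have huneg : H u u < 0 := by
      refine lt_of_le_of_ne (hneg u) fun h => hu0 ?_
      exact (Submodule.disjoint_def.1 hR) u (hker u h) hu.1
    refine ⟨-H u u, by linarith, fun v hv => ?_⟩
    by_cases hv0 : v = 0
    · simp [hv0]
    have hmem : ‖v‖⁻¹ • v ∈ S := ⟨R.smul_mem _ hv, by simp [norm_smul, hv0]⟩
    have h1 : H (‖v‖⁻¹ • v) (‖v‖⁻¹ • v) ≤ H u u := hmax hmem
    simp only [map_smul, smul_apply, smul_eq_mul] at h1
    have hvn : 0 < ‖v‖ := norm_pos_iff.2 hv0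
    have h2 : H v v = ‖v‖ ^ 2 * (‖v‖⁻¹ * (‖v‖⁻¹ * H v v)) := by field_simp
    rw [h2]
    nlinarith [mul_le_mul_of_nonneg_left h1 (sq_nonneg ‖v‖)]

end Calculus

/-! ### Quadratic growth in a product of vector spaces. -/

section Flat

variable {A W Q : Type*} [NormedAddCommGroup A] [NormedSpace ℝ A]
  [NormedAddCommGroup W] [NormedSpace ℝ W]
  [NormedAddCommGroup Q] [NormedSpace ℝ Q]

/-- `x` is a critical point of `g (a, ·)`, where `z = (a, x)`. -/
def IsFiberCritical (g : A × W → ℝ) (z : A × W) : Prop :=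
  ∀ w : W, fderiv ℝ g z (0, w) = 0

/-- The second derivative of `g (a, ·)` at `x`, where `z = (a, x)`. -/
noncomputable def fiberHess (g : A × W → ℝ) (z : A × W) : W →L[ℝ] W →L[ℝ] ℝ :=
  (fderiv ℝ (fderiv ℝ g) z).bilinearComp (ContinuousLinearMap.inr ℝ A W)
    (ContinuousLinearMap.inr ℝ A W)

theorem fiberHess_apply (g : A × W → ℝ) (z : A × W) (v w : W) :
    fiberHess g z v w = fderiv ℝ (fderiv ℝ g) z (0, v) (0, w) := rfl

theorem hasFDerivAt_fderiv_fiber {g : A × W → ℝ} {z : A × W} (hg : ContDiffAt ℝ 2 g z) :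
    HasFDerivAt (fun x => (fderiv ℝ g (z.1, x)).comp (ContinuousLinearMap.inr ℝ A W))
      (fiberHess g z) z.2 := by
  have h : HasFDerivAt (fun x => fderiv ℝ g (z.1, x))
      ((fderiv ℝ (fderiv ℝ g) z).comp (ContinuousLinearMap.inr ℝ A W)) z.2 :=
    HasFDerivAt.comp (g := fderiv ℝ g) (f := fun x => (z.1, x)) z.2
      (differentiableAt_fderiv_of_contDiffAt hg).hasFDerivAt (hasFDerivAt_prodMk_right z.1 z.2)
  exact ((ContinuousLinearMap.compL ℝ W (A × W) ℝ).flip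
    (ContinuousLinearMap.inr ℝ A W)).hasFDerivAt.comp z.2 h

variable [FiniteDimensional ℝ W]

/-- Maximality makes the fibre Hessian at `z₀` semidefinite, hence coercive on `R`; continuity of
the second derivative preserves half of the constant nearby. -/
theorem exists_eventually_fiber_coercive {g : A × W → ℝ} {z₀ : A × W}
    (hg : ContDiffAt ℝ 2 g z₀) (hmax : IsLocalMax (fun x => g (z₀.1, x)) z₀.2)
    (R : Submodule ℝ W) (hR : Disjoint (LinearMap.ker (fiberHess g z₀).toLinearMap) R) :
    ∃ c > 0, ∀ᶠ z in 𝓝 z₀, ∀ r ∈ R,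
      fderiv ℝ (fderiv ℝ g) z (0, r) (0, r) ≤ -(c * ‖r‖ ^ 2) := by
  have hsymm := hg.isSymmSndFDerivAt (by simp)
  obtain ⟨c, hc, hcoer⟩ := exists_coercive_of_disjoint_ker (fiberHess g z₀)
    (fun v w => hsymm _ _) (fun v => by
      refine fderiv_fderiv_nonpos_of_isLocalMax hg ?_
      have hcont : Tendsto (fun t : ℝ => z₀.2 + t • v) (𝓝 0) (𝓝 z₀.2) := by
        have : Continuous (fun t : ℝ => z₀.2 + t • v) := by fun_prop
        simpa using this.tendsto 0
      filter_upwards [hcont.eventually hmax] with t ht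
      convert ht using 2 <;> ext <;> simp) R hR
  refine ⟨c / 2, half_pos hc, ?_⟩
  filter_upwards [eventually_norm_fderiv_fderiv_sub_lt hg (half_pos hc)] with z hz r hr
  have h1 := hcoer r hr
  rw [fiberHess_apply] at h1
  set D := fderiv ℝ (fderiv ℝ g) z
  set D₀ := fderiv ℝ (fderiv ℝ g) z₀
  have h2 : (D - D₀) (0, r) (0, r) ≤ c / 2 * ‖r‖ * ‖r‖ := by
    have hn : ‖((0 : A), r)‖ = ‖r‖ := by simp [Prod.norm_def]
    calc (D - D₀) (0, r) (0, r) ≤ ‖(D - D₀) (0, r) (0, r)‖ := le_abs_self _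
      _ ≤ ‖D - D₀‖ * ‖((0 : A), r)‖ * ‖((0 : A), r)‖ := (D - D₀).le_opNorm₂ _ _
      _ ≤ c / 2 * ‖r‖ * ‖r‖ := by
        rw [hn]
        have : ‖D - D₀‖ ≤ c / 2 := hz.le
        gcongr
  simp only [sub_apply] at h2
  nlinarith

variable [FiniteDimensional ℝ A] [FiniteDimensional ℝ Q]

/-- If the critical points of the functions `g (a, ·)` near `z₀` are parametrized by an immersion
`ψ` from a space of dimension at least `dim A + dim ker Hess g (a₀, ·)`, then near `z₀` every point
`(a, x)` has a critical point `ζ` of `g (a, ·)`, at the level of all other nearby critical points,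
such that `g (a, ·)` grows quadratically between `x` and `ζ`. -/
theorem exists_quadratic_growth_of_fiberCritical {g : A × W → ℝ} {z₀ : A × W} {q₀ : Q}
    {ψ : Q → A × W} {lam : A × W → Q}
    (hg : ContDiffAt ℝ 2 g z₀) (hmax : IsLocalMax (fun x => g (z₀.1, x)) z₀.2)
    (hψ : ContDiffAt ℝ 1 ψ q₀) (hlam : ContDiffAt ℝ 1 lam z₀)
    (hψ₀ : ψ q₀ = z₀) (hlam₀ : lam z₀ = q₀)
    (hleft : ∀ᶠ q in 𝓝 q₀, lam (ψ q) = q)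
    (hcrit : ∀ᶠ q in 𝓝 q₀, IsFiberCritical g (ψ q))
    (hright : ∀ᶠ z in 𝓝 z₀, IsFiberCritical g z → ψ (lam z) = z)
    (hdim : Module.finrank ℝ A +
      Module.finrank ℝ (LinearMap.ker (fiberHess g z₀).toLinearMap) ≤ Module.finrank ℝ Q)
    {U : Set W} (hU : U ∈ 𝓝 z₀.2) :
    ∃ c > 0, ∀ᶠ p in 𝓝 (z₀.1, z₀.2, z₀.2), IsFiberCritical g (p.1, p.2.2) →
      ∃ ζ ∈ U, g (p.1, ζ) = g (p.1, p.2.2) ∧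
        c * ‖p.2.1 - ζ‖ ^ 2 ≤ g (p.1, ζ) - g (p.1, p.2.1) := by
  set K := LinearMap.ker (fiberHess g z₀).toLinearMap with hK
  obtain ⟨R, hKR⟩ := Submodule.exists_isCompl K
  obtain ⟨c, hc, hcoer⟩ := exists_eventually_fiber_coercive hg hmax R hKR.disjoint
  -- the map adding to a critical point a displacement in `R`
  let T : Q × R → A × W := fun y => ψ y.1 + (0, (y.2 : W))
  have hT : ContDiffAt ℝ 1 T (q₀, 0) := by
    have h1 : ContDiffAt ℝ 1 (fun y : Q × R => ψ y.1) (q₀, 0) :=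
      ContDiffAt.comp (g := ψ) (q₀, (0 : R)) hψ contDiffAt_fst
    have h2 : ContDiff ℝ 1 (fun y : Q × R => ((0 : A), (y.2 : W))) :=
      contDiff_const.prodMk (R.subtypeL.contDiff.comp contDiff_snd)
    exact h1.add h2.contDiffAt
  have hT₀ : T (q₀, 0) = z₀ := by simp [T, hψ₀]
  have hψd := (hψ.differentiableAt (by norm_num)).hasFDerivAt
  let T' : Q × R →L[ℝ] A × W :=
    (fderiv ℝ ψ q₀).comp (ContinuousLinearMap.fst ℝ Q R) +
      (ContinuousLinearMap.inr ℝ A W).comp (R.subtypeL.comp (ContinuousLinearMap.snd ℝ Q R))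
  have hT' : HasFDerivAt T T' (q₀, 0) := by
    have h1 : HasFDerivAt (fun y : Q × R => ψ y.1)
        ((fderiv ℝ ψ q₀).comp (ContinuousLinearMap.fst ℝ Q R)) (q₀, 0) :=
      HasFDerivAt.comp (g := ψ) (q₀, (0 : R)) hψd hasFDerivAt_fst
    exact h1.add ((ContinuousLinearMap.inr ℝ A W).comp
      (R.subtypeL.comp (ContinuousLinearMap.snd ℝ Q R))).hasFDerivAt
  have hψinj : ∀ q, fderiv ℝ ψ q₀ q = 0 → q = 0 := by
    intro q hq
    have hld : HasFDerivAt lam (fderiv ℝ lam z₀) (ψ q₀) := by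
      rw [hψ₀]; exact (hlam.differentiableAt (by norm_num)).hasFDerivAt
    have h1 := hld.comp q₀ hψd
    have h2 : HasFDerivAt (lam ∘ ψ) (ContinuousLinearMap.id ℝ Q) q₀ :=
      (hasFDerivAt_id q₀).congr_of_eventuallyEq hleft
    have h3 := congrArg (fun l : Q →L[ℝ] Q => l q) (h1.unique h2)
    simpa [hq] using h3.symm
  -- Differentiate `fderiv ℝ g (ψ q) (0, w') = 0` in `q`: a vertical velocity `(0, w)` of `ψ`
  -- satisfies `fiberHess g z₀ w w' = 0` for all `w'`.
  have hψK : ∀ q w, fderiv ℝ ψ q₀ q = (0, w) → w ∈ K := by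
    intro q w hq
    refine LinearMap.mem_ker.2 ?_
    ext w'
    have hd : HasFDerivAt (fderiv ℝ g) (fderiv ℝ (fderiv ℝ g) z₀) (ψ q₀) := by
      rw [hψ₀]; exact (differentiableAt_fderiv_of_contDiffAt hg).hasFDerivAt
    have h1 := (ContinuousLinearMap.apply ℝ ℝ ((0 : A), w')).hasFDerivAt.comp q₀ (hd.comp q₀ hψd)
    have h2 : HasFDerivAt ((ContinuousLinearMap.apply ℝ ℝ ((0 : A), w')) ∘ (fderiv ℝ g ∘ ψ))
        (0 : Q →L[ℝ] ℝ) q₀ := by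
      refine (hasFDerivAt_const (0 : ℝ) q₀).congr_of_eventuallyEq ?_
      filter_upwards [hcrit] with q hq using hq w'
    have h3 := congrArg (fun l : Q →L[ℝ] ℝ => l q) (h1.unique h2)
    simpa [hq, fiberHess_apply] using h3
  have hTinj : Function.Injective T' := by
    refine (injective_iff_map_eq_zero T').2 ?_
    rintro ⟨q, r⟩ h
    have h1 : fderiv ℝ ψ q₀ q = (0, -(r : W)) := by
      have : fderiv ℝ ψ q₀ q + ((0 : A), (r : W)) = 0 := h
      rw [eq_neg_of_add_eq_zero_left this]
      simp
    have h2 : (r : W) ∈ K := by simpa using K.neg_mem (hψK q _ h1)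
    have h3 : (r : W) = 0 := Submodule.disjoint_def.1 hKR.disjoint _ h2 r.2
    have h4 : r = 0 := Subtype.ext h3
    subst h4
    simp only [ZeroMemClass.coe_zero, neg_zero] at h1
    rw [hψinj q h1]; rfl
  -- Injectivity gives one inequality; the other is `hdim` with `dim W = dim K + dim R`. This is
  -- where the Morse-Bott dimension enters.
  have hrank : Module.finrank ℝ (Q × R) = Module.finrank ℝ (A × W) := by
    refine le_antisymm (LinearMap.finrank_le_finrank_of_injective (f := T'.toLinearMap) hTinj) ?_
    have := Submodule.finrank_add_eq_of_isCompl hKR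
    rw [Module.finrank_prod, Module.finrank_prod]
    omega
  let e : (Q × R) ≃L[ℝ] (A × W) :=
    (LinearEquiv.ofInjectiveOfFinrankEq T'.toLinearMap hTinj hrank).toContinuousLinearEquiv
  have he : (e : Q × R →L[ℝ] A × W) = T' := by ext y <;> rfl
  have hT'' : HasFDerivAt T (e : Q × R →L[ℝ] A × W) (q₀, 0) := by rw [he]; exact hT'
  have hstrict := hT.hasStrictFDerivAt' hT'' (by norm_num)
  let S := hT.localInverse hT'' (by norm_num)
  have hS : ContDiffAt ℝ 1 S z₀ := hT₀ ▸ hT.to_localInverse hT'' (by norm_num)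
  have hS₀ : S z₀ = (q₀, 0) := by
    have := hT.localInverse_apply_image hT'' (by norm_num)
    rwa [hT₀] at this
  have hTS : ∀ᶠ z in 𝓝 z₀, T (S z) = z := hT₀ ▸ hstrict.eventually_right_inverse
  have hST : ∀ᶠ y in 𝓝 (q₀, (0 : R)), S (T y) = y := hstrict.eventually_left_inverse
  -- the resulting projection onto the critical set
  let P : A × W → A × W := fun z => z - (0, ((S z).2 : W))
  have hP : ContDiffAt ℝ 1 P z₀ :=
    contDiffAt_id.sub (contDiffAt_const.prodMk
      (R.subtypeL.contDiff.contDiffAt.comp z₀ (contDiffAt_snd.comp z₀ hS)))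
  have hP₀ : P z₀ = z₀ := by simp [P, hS₀]
  have hPt : Tendsto P (𝓝 z₀) (𝓝 z₀) := by simpa [ContinuousAt, hP₀] using hP.continuousAt
  have hSt : Tendsto S (𝓝 z₀) (𝓝 (q₀, 0)) := by
    simpa [ContinuousAt, hS₀] using hS.continuousAt
  have hPcrit : ∀ᶠ z in 𝓝 z₀, IsFiberCritical g (P z) := by
    have hq : ∀ᶠ z in 𝓝 z₀, IsFiberCritical g (ψ (S z).1) :=
      (continuousAt_fst.tendsto.comp hSt).eventually hcrit
    filter_upwards [hq, hTS] with z h1 h2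
    have : P z = ψ (S z).1 := by
      change z - _ = _
      rw [sub_eq_iff_eq_add]
      exact h2.symm
    rwa [this]
  -- A critical `z` near `z₀` is `T (lam z, 0)`, so its `R`-component under the local inverse is
  -- zero.
  have hPfix : ∀ᶠ z in 𝓝 z₀, IsFiberCritical g z → P z = z := by
    have hl : Tendsto (fun z => (lam z, (0 : R))) (𝓝 z₀) (𝓝 (q₀, 0)) := by
      have : Tendsto lam (𝓝 z₀) (𝓝 q₀) := by simpa [ContinuousAt, hlam₀] using hlam.continuousAt
      exact this.prodMk_nhds tendsto_const_nhds
    filter_upwards [hright, hl.eventually hST] with z h1 h2 h3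
    have h4 : T (lam z, 0) = z := by simp [T, h1 h3]
    rw [h4] at h2
    simp [P, h2]
  -- a ball on which everything holds
  have hall := ((hg.eventually (by norm_num)).and hcoer).and
    (((hP.eventually (by norm_num)).and hPcrit).and
      (hPfix.and (hPt.eventually (hg.eventually (by norm_num)))))
  obtain ⟨ε, hε, hball⟩ := Metric.eventually_nhds_iff_ball.1 hall
  -- `P` preserves the first coordinate, so its fibre derivative is vertical, and `g` has zero
  -- vertical derivative at the critical point `P (a, u)`. The slice of the ball is convex because
  -- the product carries the sup metric.
  have hconst : ∀ a x x', (a, x) ∈ Metric.ball z₀ ε → (a, x') ∈ Metric.ball z₀ ε →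
      g (P (a, x)) = g (P (a, x')) := by
    intro a x x' hx hx'
    let s : Set W := (fun x => (a, x)) ⁻¹' Metric.ball z₀ ε
    have hsopen : IsOpen s := Metric.isOpen_ball.preimage (by fun_prop)
    have hsconv : Convex ℝ s := by
      have : s = {x | (a, x) ∈ Metric.ball z₀.1 ε ×ˢ Metric.ball z₀.2 ε} := by
        ext x; simp [s, Prod.dist_eq]
      rw [this]
      intro u hu v hv α β hα hβ hαβ
      exact ⟨hu.1, (convex_ball z₀.2 ε) hu.2 hv.2 hα hβ hαβ⟩
    have hder : ∀ u ∈ s, HasFDerivAt (fun x => g (P (a, x))) (0 : W →L[ℝ] ℝ) u := by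
      intro u hu
      obtain ⟨-, ⟨hPu, hcu⟩, -, hgu⟩ := hball _ hu
      have h1 : HasFDerivAt (fun x => P (a, x))
          ((fderiv ℝ P (a, u)).comp (ContinuousLinearMap.inr ℝ A W)) u :=
        (hPu.differentiableAt (by norm_num)).hasFDerivAt.comp u (hasFDerivAt_prodMk_right a u)
      have h2 := (hgu.differentiableAt (by norm_num)).hasFDerivAt.comp u h1
      refine h2.congr_fderiv ?_
      ext w
      have h3 : HasFDerivAt (fun x => (P (a, x)).1) (0 : W →L[ℝ] A) u := by
        have : (fun x => (P (a, x)).1) = fun _ : W => a := by ext x; simp [P]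
        rw [this]; exact hasFDerivAt_const a u
      have h4 := congrArg (fun l : W →L[ℝ] A => l w) (h3.unique h1.fst)
      have h5 : fderiv ℝ P (a, u) (0, w) = (0, (fderiv ℝ P (a, u) (0, w)).2) := by
        ext
        · simpa using h4.symm
        · rfl
      change fderiv ℝ g (P (a, u)) (fderiv ℝ P (a, u) (0, w)) = 0
      rw [h5]
      exact hcu _
    refine hsconv.is_const_of_fderivWithin_eq_zero (𝕜 := ℝ) (f := fun x => g (P (a, x)))
      (fun u hu => (hder u hu).differentiableAt.differentiableWithinAt) (fun u hu => ?_) hx hx'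
    rw [fderivWithin_of_isOpen hsopen hu, (hder u hu).fderiv]
  refine ⟨c / 2, half_pos hc, ?_⟩
  have ht1 : Tendsto (fun p : A × W × W => (p.1, p.2.1)) (𝓝 (z₀.1, z₀.2, z₀.2)) (𝓝 z₀) :=
    Continuous.tendsto (by fun_prop) _
  have ht2 : Tendsto (fun p : A × W × W => (p.1, p.2.2)) (𝓝 (z₀.1, z₀.2, z₀.2)) (𝓝 z₀) :=
    Continuous.tendsto (by fun_prop) _
  have hbn : ∀ᶠ z in 𝓝 z₀, z ∈ Metric.ball z₀ ε := Metric.ball_mem_nhds _ hε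
  have hUn : ∀ᶠ z in 𝓝 z₀, (P z).2 ∈ U :=
    (continuousAt_snd.tendsto.comp hPt).eventually hU
  filter_upwards [ht1.eventually hbn, ht2.eventually hbn, ht1.eventually (hPt.eventually hbn),
    ht1.eventually hUn]
  rintro ⟨a, x, x'⟩ hx hx' hPx hUx hcx'
  have hPa : P (a, x) = (a, (P (a, x)).2) := by ext <;> simp [P]
  refine ⟨(P (a, x)).2, hUx, ?_, ?_⟩
  · rw [← hPa, hconst a x x' hx hx', (hball _ hx').2.2.1 hcx']
  · rw [← hPa]
    set r := (S (a, x)).2 with hr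
    have hadd : P (a, x) + (0, (r : W)) = (a, x) := by simp [P, hr]
    -- The segment runs from the critical point `P (a, x)` to `(a, x)` along `r ∈ R`, inside the
    -- ball where `R` is coercive; the factor `1/2` of Taylor's formula turns `c` into `c / 2`.
    have := le_sub_of_fderiv_fderiv_le (convex_ball z₀ ε) (fun y hy => (hball y hy).1.1) hPx
      (by rw [hadd]; exact hx) ((hball _ hx).2.1.2 (r : W))
      (fun y hy => (hball y hy).1.2 r r.2)
    rw [hadd] at this
    have hn : x - (P (a, x)).2 = r := by simp [P, hr]
    simp only [hn]
    linarith

end Flat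

/-! ### Tangent spaces, Riemannian gradient and Hessian in slice charts. -/

section Charts

variable {E : Type*} [NormedAddCommGroup E] [NormedSpace ℝ E]

theorem IsSmoothDiffeo.contDiffAt {Φ : OpenPartialHomeomorph E E} (hΦ : IsSmoothDiffeo Φ) {x : E}
    (hx : x ∈ Φ.source) : ContDiffAt ℝ ∞ Φ x :=
  hΦ.1.contDiffAt (Φ.open_source.mem_nhds hx)

theorem IsSmoothDiffeo.contDiffAt_symm {Φ : OpenPartialHomeomorph E E} (hΦ : IsSmoothDiffeo Φ)
    {y : E} (hy : y ∈ Φ.target) : ContDiffAt ℝ ∞ Φ.symm y :=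
  hΦ.2.contDiffAt (Φ.open_target.mem_nhds hy)

theorem IsSmoothDiffeo.hasFDerivAt {Φ : OpenPartialHomeomorph E E} (hΦ : IsSmoothDiffeo Φ) {x : E}
    (hx : x ∈ Φ.source) : HasFDerivAt Φ (fderiv ℝ Φ x) x :=
  ((hΦ.contDiffAt hx).differentiableAt (by simp)).hasFDerivAt

theorem IsSmoothDiffeo.hasFDerivAt_symm {Φ : OpenPartialHomeomorph E E} (hΦ : IsSmoothDiffeo Φ)
    {y : E} (hy : y ∈ Φ.target) : HasFDerivAt Φ.symm (fderiv ℝ Φ.symm y) y :=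
  ((hΦ.contDiffAt_symm hy).differentiableAt (by simp)).hasFDerivAt

theorem IsSmoothDiffeo.fderiv_symm_fderiv {Φ : OpenPartialHomeomorph E E} (hΦ : IsSmoothDiffeo Φ)
    {y : E} (hy : y ∈ Φ.target) (v : E) :
    fderiv ℝ Φ.symm y (fderiv ℝ Φ (Φ.symm y) v) = v := by
  have h1 : HasFDerivAt Φ.symm (fderiv ℝ Φ.symm y) (Φ (Φ.symm y)) := by
    rw [Φ.right_inv hy]; exact hΦ.hasFDerivAt_symm hy
  have h2 := h1.comp _ (hΦ.hasFDerivAt (Φ.map_target hy))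
  have h3 : HasFDerivAt (Φ.symm ∘ Φ) (ContinuousLinearMap.id ℝ E) (Φ.symm y) :=
    (hasFDerivAt_id _).congr_of_eventuallyEq (Φ.eventually_left_inverse (Φ.map_target hy))
  exact congrArg (fun l : E →L[ℝ] E => l v) (h2.unique h3)

theorem IsSmoothDiffeo.fderiv_fderiv_symm {Φ : OpenPartialHomeomorph E E} (hΦ : IsSmoothDiffeo Φ)
    {y : E} (hy : y ∈ Φ.target) (v : E) :
    fderiv ℝ Φ (Φ.symm y) (fderiv ℝ Φ.symm y v) = v := by
  have h2 := (hΦ.hasFDerivAt (Φ.map_target hy)).comp y (hΦ.hasFDerivAt_symm hy)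
  have h3 : HasFDerivAt (Φ ∘ Φ.symm) (ContinuousLinearMap.id ℝ E) y :=
    (hasFDerivAt_id _).congr_of_eventuallyEq (Φ.eventually_right_inverse hy)
  exact congrArg (fun l : E →L[ℝ] E => l v) (h2.unique h3)

/-- A linear projection onto `W` agrees with the identity on `W`, so their derivatives agree on
tangent vectors. -/
theorem tangentConeAt_submodule_subset [FiniteDimensional ℝ E] (W : Submodule ℝ E) {x : E}
    (hx : x ∈ W) : tangentConeAt ℝ (W : Set E) x ⊆ W := by
  obtain ⟨p, hp⟩ := Submodule.ClosedComplemented.of_finiteDimensional W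
  intro t ht
  have h1 : HasFDerivWithinAt (W.subtypeL.comp p) (W.subtypeL.comp p) (W : Set E) x :=
    (W.subtypeL.comp p).hasFDerivWithinAt
  have hfix : ∀ y ∈ W, (W.subtypeL.comp p) y = y := fun y hy => by
    simpa using congrArg Subtype.val (hp ⟨y, hy⟩)
  have h2 : HasFDerivWithinAt (W.subtypeL.comp p) (ContinuousLinearMap.id ℝ E) (W : Set E) x :=
    (hasFDerivWithinAt_id x _).congr hfix (hfix x hx)
  have h3 : (p t : E) = t := h1.unique_on h2 ht
  rw [← h3]
  exact (p t).2

theorem mem_tangentConeAt_submodule (W : Submodule ℝ E) {x w : E} (hx : x ∈ W) (hw : w ∈ W) :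
    w ∈ tangentConeAt ℝ (W : Set E) x := by
  have := mem_tangentConeAt_of_segment_subset (s := (W : Set E)) (x := x) (y := x + w)
    (W.convex.segment_subset hx (W.add_mem hx hw))
  simpa using this

/-- In a slice chart, the tangent space is the image of the model subspace. -/
theorem tangentSpace_eq_map [FiniteDimensional ℝ E] {S : Set E} {Φ : OpenPartialHomeomorph E E}
    {W : Submodule ℝ E} (hΦ : IsSmoothDiffeo Φ) (hS : ∀ y ∈ Φ.source, y ∈ S ↔ Φ y ∈ W) {x : E}
    (hx : x ∈ Φ.target) (hxW : x ∈ W) :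
    tangentSpace S (Φ.symm x) = W.map (fderiv ℝ Φ.symm x).toLinearMap := by
  apply le_antisymm
  · refine Submodule.span_le.2 fun t ht => ?_
    have hsrc := Φ.map_target hx
    refine ⟨fderiv ℝ Φ (Φ.symm x) t, ?_, hΦ.fderiv_symm_fderiv hx t⟩
    rw [← tangentConeAt_inter_nhds (Φ.open_source.mem_nhds hsrc)] at ht
    have h1 := (hΦ.hasFDerivAt hsrc).hasFDerivWithinAt.mapsTo_tangent_cone ht
    rw [Φ.right_inv hx] at h1
    refine tangentConeAt_submodule_subset W hxW (tangentConeAt_mono ?_ h1)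
    rintro _ ⟨y, ⟨hyS, hy⟩, rfl⟩
    exact (hS y hy).1 hyS
  · rintro _ ⟨w, hw, rfl⟩
    refine Submodule.subset_span ?_
    have hwt := mem_tangentConeAt_submodule W hxW hw
    rw [← tangentConeAt_inter_nhds (Φ.open_target.mem_nhds hx)] at hwt
    have h1 := (hΦ.hasFDerivAt_symm hx).hasFDerivWithinAt.mapsTo_tangent_cone hwt
    refine tangentConeAt_mono ?_ h1
    rintro _ ⟨y, ⟨hyW, hy⟩, rfl⟩
    rw [hS _ (Φ.map_target hy), Φ.right_inv hy]
    exact hyW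

/-- Differentiability within `S` becomes full differentiability on `W`, since `Φ.symm` sends a
neighbourhood of `x` in `W` into `S`. -/
theorem hasFDerivAt_comp_slice {G : Type*} [NormedAddCommGroup G] [NormedSpace ℝ G]
    {S : Set E} {Φ : OpenPartialHomeomorph E E}
    {W : Submodule ℝ E} (hΦ : IsSmoothDiffeo Φ) (hS : ∀ y ∈ Φ.source, y ∈ S ↔ Φ y ∈ W) {x : W}
    (hx : (x : E) ∈ Φ.target) {h : E → G} (hh : DifferentiableWithinAt ℝ h S (Φ.symm x)) :
    HasFDerivAt (fun u : W => h (Φ.symm u))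
      ((fderivWithin ℝ h S (Φ.symm x)).comp ((fderiv ℝ Φ.symm (x : E)).comp W.subtypeL)) x := by
  have h1 : HasFDerivAt (fun u : W => Φ.symm (u : E)) ((fderiv ℝ Φ.symm (x : E)).comp W.subtypeL)
      x := (hΦ.hasFDerivAt_symm hx).comp x W.subtypeL.hasFDerivAt
  have hnear : ∀ᶠ u : W in 𝓝 x, (u : E) ∈ Φ.target :=
    continuousAt_subtype_val.eventually (Φ.open_target.mem_nhds hx)
  have h2 := hh.hasFDerivWithinAt.comp (s := {u : W | (u : E) ∈ Φ.target}) x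
    h1.hasFDerivWithinAt (fun u hu => by
      rw [hS _ (Φ.map_target hu), Φ.right_inv hu]; exact u.2)
  exact h2.hasFDerivAt hnear

variable {F : Type*} [NormedAddCommGroup F] [InnerProductSpace ℝ F] [FiniteDimensional ℝ F]
  {S : Set F} {Φ : OpenPartialHomeomorph F F} {W : Submodule ℝ F}

theorem inner_riemGrad_slice (hΦ : IsSmoothDiffeo Φ) (hS : ∀ y ∈ Φ.source, y ∈ S ↔ Φ y ∈ W)
    {x : W} (hx : (x : F) ∈ Φ.target) {h : F → ℝ} (w : W) :
    inner ℝ (riemGrad h S (Φ.symm x)) (fderiv ℝ Φ.symm (x : F) w) =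
      fderivWithin ℝ h S (Φ.symm x) (fderiv ℝ Φ.symm (x : F) w) := by
  have hmem : fderiv ℝ Φ.symm (x : F) w ∈ tangentSpace S (Φ.symm x) := by
    rw [tangentSpace_eq_map hΦ hS hx x.2]
    exact ⟨w, w.2, rfl⟩
  rw [riemGrad, Submodule.inner_starProjection_left_eq_right,
    Submodule.starProjection_eq_self_iff.2 hmem, inner_gradientWithin_left]

/-- The gradient is itself tangent, hence the image of some `w ∈ W`; testing it against that vector
gives its squared norm. -/
theorem riemGrad_eq_zero_iff_slice (hΦ : IsSmoothDiffeo Φ)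
    (hS : ∀ y ∈ Φ.source, y ∈ S ↔ Φ y ∈ W) {x : W} (hx : (x : F) ∈ Φ.target) {h : F → ℝ} :
    riemGrad h S (Φ.symm x) = 0 ↔
      ∀ w : W, fderivWithin ℝ h S (Φ.symm x) (fderiv ℝ Φ.symm (x : F) w) = 0 := by
  constructor
  · intro h0 w
    rw [← inner_riemGrad_slice hΦ hS hx, h0, inner_zero_left]
  · intro h0
    have hmem : riemGrad h S (Φ.symm x) ∈ tangentSpace S (Φ.symm x) :=
      Submodule.starProjection_apply_mem _ _
    rw [tangentSpace_eq_map hΦ hS hx x.2] at hmem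
    obtain ⟨w, hw, hwe⟩ := hmem
    rw [← inner_self_eq_zero (𝕜 := ℝ)]
    nth_rw 2 [← hwe]
    exact (inner_riemGrad_slice hΦ hS hx ⟨w, hw⟩).trans (h0 ⟨w, hw⟩)

/-- The kernel of the Riemannian Hessian at a critical point is at least as large as the kernel of
the Hessian in a slice chart. -/
theorem finrank_ker_le_finrank_ker_riemHess (hΦ : IsSmoothDiffeo Φ)
    (hS : ∀ y ∈ Φ.source, y ∈ S ↔ Φ y ∈ W) {x : W} (hx : (x : F) ∈ Φ.target) {h : F → ℝ}
    {G : W → W →L[ℝ] ℝ} {H : W →L[ℝ] W →L[ℝ] ℝ} (hcrit : riemGrad h S (Φ.symm x) = 0)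
    (hG : ∀ᶠ u : W in 𝓝 x, ∀ w : W,
      fderivWithin ℝ h S (Φ.symm u) (fderiv ℝ Φ.symm (u : F) w) = G u w)
    (hH : HasFDerivAt G H x) :
    Module.finrank ℝ (LinearMap.ker H.toLinearMap) ≤
      Module.finrank ℝ (LinearMap.ker (riemHess h S (Φ.symm x))) := by
  have hT := tangentSpace_eq_map hΦ hS hx x.2
  have hmem : ∀ w : W, fderiv ℝ Φ.symm (x : F) w ∈ tangentSpace S (Φ.symm x) := fun w => by
    rw [hT]; exact ⟨w, w.2, rfl⟩
  have hker : ∀ w : W, H w = 0 → riemHess h S (Φ.symm x) ⟨_, hmem w⟩ = 0 := by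
    intro w' hw'
    change (tangentSpace S (Φ.symm x)).orthogonalProjectionOnto
      (fderivWithin ℝ (riemGrad h S) S (Φ.symm x) (fderiv ℝ Φ.symm (x : F) w')) = 0
    by_cases hd : DifferentiableWithinAt ℝ (riemGrad h S) S (Φ.symm x)
    · rw [Submodule.orthogonalProjectionOnto_eq_zero_iff, Submodule.mem_orthogonal', hT]
      rintro _ ⟨w, hw, rfl⟩
      have h1 := hasFDerivAt_comp_slice hΦ hS hx hd
      have hDs : HasFDerivAt (fderiv ℝ Φ.symm) (fderiv ℝ (fderiv ℝ Φ.symm) (x : F)) (x : F) :=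
        (((hΦ.contDiffAt_symm hx).fderiv_right (m := ∞) le_rfl).differentiableAt
          (by simp)).hasFDerivAt
      have h2 := (ContinuousLinearMap.apply ℝ F w).hasFDerivAt.comp x
        (hDs.comp x W.subtypeL.hasFDerivAt)
      -- Product rule for `⟨grad h, DΦ⁻¹ w⟩ = G · w`: the term with the second derivative of `Φ⁻¹`
      -- vanishes because the gradient is zero at the point.
      have h3 := h1.inner ℝ h2
      have h4 := (ContinuousLinearMap.apply ℝ ℝ (⟨w, hw⟩ : W)).hasFDerivAt.comp x hH
      have hnear : ∀ᶠ u : W in 𝓝 x, (u : F) ∈ Φ.target :=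
        continuousAt_subtype_val.eventually (Φ.open_target.mem_nhds hx)
      have h5 := h4.congr_of_eventuallyEq (f₁ := fun u : W =>
        inner ℝ (riemGrad h S (Φ.symm u)) (fderiv ℝ Φ.symm (u : F) w)) (by
          filter_upwards [hG, hnear] with u hu hut
          rw [inner_riemGrad_slice hΦ hS hut ⟨w, hw⟩]
          exact hu _)
      have h6 := congrArg (fun l : W →L[ℝ] ℝ => l w') (h3.unique h5)
      simpa [hcrit, hw', fderivInnerCLM_apply] using h6
    -- Without differentiability the derivative defaults to zero, so the Hessian kills everything.
    · rw [fderivWithin_zero_of_not_differentiableWithinAt hd]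
      simp
  let L : LinearMap.ker H.toLinearMap →ₗ[ℝ] LinearMap.ker (riemHess h S (Φ.symm x)) :=
    LinearMap.codRestrict _ (LinearMap.codRestrict (tangentSpace S (Φ.symm x))
      ((fderiv ℝ Φ.symm (x : F)).toLinearMap ∘ₗ W.subtype ∘ₗ Submodule.subtype _)
      (fun w => hmem w)) (fun w => LinearMap.mem_ker.2 (hker w w.2))
  refine LinearMap.finrank_le_finrank_of_injective (f := L) ?_
  intro u v huv
  have h1 : fderiv ℝ Φ.symm (x : F) ((u : W) : F) = fderiv ℝ Φ.symm (x : F) ((v : W) : F) :=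
    congrArg Subtype.val (congrArg Subtype.val huv)
  have h2 := congrArg (fderiv ℝ Φ (Φ.symm x)) h1
  rw [hΦ.fderiv_fderiv_symm hx, hΦ.fderiv_fderiv_symm hx] at h2
  exact Subtype.ext (Subtype.ext h2)

end Charts

/-! ### Local quadratic growth on the manifolds. -/

section Growth

/-- Near a maximizer lying in a slice chart, a parametric Morse-Bott function grows quadratically
away from some maximizer. -/
theorem exists_local_quadratic_growth {E F : Type*} [NormedAddCommGroup E] [NormedSpace ℝ E]
    [FiniteDimensional ℝ E] [NormedAddCommGroup F] [InnerProductSpace ℝ F] [FiniteDimensional ℝ F]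
    {Θ : Set E} {Ξ : Set F} {k d : ℕ} {f : E → F → ℝ}
    (hf : ContDiffOn ℝ 2 (Function.uncurry f) (Θ ×ˢ Ξ)) (hMB : IsParametricMorseBott Θ k Ξ d f)
    {θ₀ : E} {ξ₀ : F} (hθ₀ : θ₀ ∈ Θ) (hξ₀ : ξ₀ ∈ argmaxOn (f θ₀) Ξ)
    (hΘ : HasSliceChart Θ k θ₀) (hΞ : HasSliceChart Ξ d ξ₀) :
    ∃ c > 0, ∀ᶠ y in 𝓝 (θ₀, ξ₀, ξ₀), y.1 ∈ Θ → y.2.1 ∈ Ξ → y.2.2 ∈ argmaxOn (f y.1) Ξ →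
      ∃ ζ ∈ argmaxOn (f y.1) Ξ, c * ‖y.2.1 - ζ‖ ^ 2 ≤ f y.1 ζ - f y.1 y.2.1 := by
  obtain ⟨Ψ, V, hΨ, hVdim, hθsrc, hΘV⟩ := hΘ
  obtain ⟨Φ, W, hΦ, -, hξsrc, hΞW⟩ := hΞ
  -- Linear projections onto `V` and `W` make `τ` smooth on an open set of the ambient space,
  -- although it inverts `σ` only on `Θ × Ξ`.
  obtain ⟨pV, hpV⟩ := Submodule.ClosedComplemented.of_finiteDimensional V
  obtain ⟨pW, hpW⟩ := Submodule.ClosedComplemented.of_finiteDimensional W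
  have hpV' : ∀ v ∈ V, (pV v : E) = v := fun v hv => congrArg Subtype.val (hpV ⟨v, hv⟩)
  have hpW' : ∀ v ∈ W, (pW v : F) = v := fun v hv => congrArg Subtype.val (hpW ⟨v, hv⟩)
  -- the chart `τ` of `Θ × Ξ` and its inverse `σ`
  let σ : V × W → E × F := fun z => (Ψ.symm z.1, Φ.symm z.2)
  let τ : E × F → V × W := fun y => (pV (Ψ y.1), pW (Φ y.2))
  let D : Set (V × W) := {z | (z.1 : E) ∈ Ψ.target ∧ (z.2 : F) ∈ Φ.target}
  have hDopen : IsOpen D :=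
    (Ψ.open_target.preimage (by fun_prop)).inter (Φ.open_target.preimage (by fun_prop))
  let O : Set (E × F) := Ψ.source ×ˢ Φ.source
  have hOopen : IsOpen O := Ψ.open_source.prod Φ.open_source
  have hσ : ∀ z ∈ D, ContDiffAt ℝ ∞ σ z := fun z hz =>
    ((hΨ.contDiffAt_symm hz.1).comp z
      (V.subtypeL.contDiff.contDiffAt.comp z contDiffAt_fst)).prodMk
    ((hΦ.contDiffAt_symm hz.2).comp z
      (W.subtypeL.contDiff.contDiffAt.comp z contDiffAt_snd))
  have hτ : ∀ y ∈ O, ContDiffAt ℝ ∞ τ y := fun y hy =>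
    (pV.contDiff.contDiffAt.comp y ((hΨ.contDiffAt hy.1).comp y contDiffAt_fst)).prodMk
    (pW.contDiff.contDiffAt.comp y ((hΦ.contDiffAt hy.2).comp y contDiffAt_snd))
  have hσmem : ∀ z ∈ D, σ z ∈ Θ ×ˢ Ξ := fun z hz => by
    constructor
    · rw [hΘV _ (Ψ.map_target hz.1), Ψ.right_inv hz.1]; exact z.1.2
    · rw [hΞW _ (Φ.map_target hz.2), Φ.right_inv hz.2]; exact z.2.2
  have hτσ : ∀ z ∈ D, τ (σ z) = z := fun z hz => by
    ext
    · change (pV (Ψ (Ψ.symm z.1)) : E) = z.1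
      rw [Ψ.right_inv hz.1, hpV' _ z.1.2]
    · change (pW (Φ (Φ.symm z.2)) : F) = z.2
      rw [Φ.right_inv hz.2, hpW' _ z.2.2]
  have hτ1 : ∀ y ∈ O, y.1 ∈ Θ → ((τ y).1 : E) = Ψ y.1 := fun y hy hyΘ =>
    hpV' _ ((hΘV _ hy.1).1 hyΘ)
  have hτ2 : ∀ y ∈ O, y.2 ∈ Ξ → ((τ y).2 : F) = Φ y.2 := fun y hy hyΞ =>
    hpW' _ ((hΞW _ hy.2).1 hyΞ)
  have hτD : ∀ y ∈ O, y ∈ Θ ×ˢ Ξ → τ y ∈ D := fun y hy hm => by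
    refine ⟨?_, ?_⟩
    · rw [hτ1 y hy hm.1]; exact Ψ.map_source hy.1
    · rw [hτ2 y hy hm.2]; exact Φ.map_source hy.2
  have hστ : ∀ y ∈ O, y ∈ Θ ×ˢ Ξ → σ (τ y) = y := fun y hy hm => by
    ext1
    · change Ψ.symm ((τ y).1 : E) = y.1
      rw [hτ1 y hy hm.1, Ψ.left_inv hy.1]
    · change Φ.symm ((τ y).2 : F) = y.2
      rw [hτ2 y hy hm.2, Φ.left_inv hy.2]
  have hO₀ : (θ₀, ξ₀) ∈ O := ⟨hθsrc, hξsrc⟩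
  have hm₀ : (θ₀, ξ₀) ∈ Θ ×ˢ Ξ := ⟨hθ₀, hξ₀.1⟩
  set z₀ : V × W := τ (θ₀, ξ₀) with hz₀
  have hD₀ : z₀ ∈ D := hτD _ hO₀ hm₀
  have hσ₀ : σ z₀ = (θ₀, ξ₀) := hστ _ hO₀ hm₀
  have hDn : ∀ᶠ z in 𝓝 z₀, z ∈ D := hDopen.mem_nhds hD₀
  have hσt : Tendsto σ (𝓝 z₀) (𝓝 (θ₀, ξ₀)) := by
    simpa [ContinuousAt, hσ₀] using (hσ z₀ hD₀).continuousAt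
  have hτt : Tendsto τ (𝓝 (θ₀, ξ₀)) (𝓝 z₀) := (hτ _ hO₀).continuousAt
  -- the objective in the chart
  let g : V × W → ℝ := fun z => Function.uncurry f (σ z)
  -- `f` is regular only within `Θ × Ξ`, but `σ` maps the open set `D` into it, so `g` is `C²` in
  -- the full sense on `D`.
  have hgC : ∀ z ∈ D, ContDiffAt ℝ 2 g z := fun z hz => by
    have h1 : ContDiffWithinAt ℝ 2 g D z :=
      (hf _ (hσmem z hz)).comp z (((hσ z hz).of_le (WithTop.coe_le_coe.2 le_top)).contDiffWithinAt)
        hσmem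
    exact h1.contDiffAt (hDopen.mem_nhds hz)
  have hfd : ∀ y ∈ Θ ×ˢ Ξ, DifferentiableWithinAt ℝ (f y.1) Ξ y.2 := fun y hy => by
    have h1 : DifferentiableWithinAt ℝ (fun ξ : F => (y.1, ξ)) Ξ y.2 := by fun_prop
    exact DifferentiableWithinAt.comp (g := Function.uncurry f) (t := Θ ×ˢ Ξ) y.2
      ((hf y hy).differentiableWithinAt (by norm_num)) h1 fun ξ hξ => ⟨hy.1, hξ⟩
  have hgfiber : ∀ z ∈ D, HasFDerivAt (fun x => g (z.1, x))
      ((fderiv ℝ g z).comp (ContinuousLinearMap.inr ℝ V W)) z.2 := fun z hz =>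
    HasFDerivAt.comp (g := g) (f := fun x => (z.1, x)) z.2
      ((hgC z hz).differentiableAt (by norm_num)).hasFDerivAt
      (hasFDerivAt_prodMk_right z.1 z.2)
  have hgder : ∀ z ∈ D, ∀ w : W, fderivWithin ℝ (f (Ψ.symm z.1)) Ξ (Φ.symm z.2)
      (fderiv ℝ Φ.symm (z.2 : F) w) = fderiv ℝ g z (0, w) := fun z hz w => by
    have h1 := hasFDerivAt_comp_slice hΦ hΞW hz.2 (hfd _ (hσmem z hz))
    exact congrArg (fun l : W →L[ℝ] ℝ => l w) (h1.unique (hgfiber z hz))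
  have hcritiff : ∀ z ∈ D, riemGrad (f (Ψ.symm z.1)) Ξ (Φ.symm z.2) = 0 ↔ IsFiberCritical g z :=
    fun z hz => by
      rw [riemGrad_eq_zero_iff_slice hΦ hΞW hz.2]
      exact forall_congr' fun w => by rw [hgder z hz w]
  have hmaxcrit : ∀ z ∈ D, Φ.symm z.2 ∈ argmaxOn (f (Ψ.symm z.1)) Ξ →
      IsLocalMax (fun x => g (z.1, x)) z.2 := fun z hz hmax => by
    have hnear : ∀ᶠ x : W in 𝓝 z.2, (x : F) ∈ Φ.target :=
      continuousAt_subtype_val.eventually (Φ.open_target.mem_nhds hz.2)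
    filter_upwards [hnear] with x hx
    exact hmax.2 (hσmem (z.1, x) ⟨hz.1, hx⟩).2
  have hmaxcrit' : ∀ z ∈ D, Φ.symm z.2 ∈ argmaxOn (f (Ψ.symm z.1)) Ξ →
      IsFiberCritical g z := fun z hz hmax w => by
    have h1 := (hmaxcrit z hz hmax).hasFDerivAt_eq_zero (hgfiber z hz)
    exact congrArg (fun l : W →L[ℝ] ℝ => l w) h1
  have hξ₀' : Φ.symm z₀.2 ∈ argmaxOn (f (Ψ.symm z₀.1)) Ξ := by
    have h1 : Ψ.symm z₀.1 = θ₀ := congrArg Prod.fst hσ₀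
    have h2 : Φ.symm z₀.2 = ξ₀ := congrArg Prod.snd hσ₀
    rw [h1, h2]; exact hξ₀
  have hmax₀ := hmaxcrit z₀ hD₀ hξ₀'
  have hcrit₀ := (hcritiff z₀ hD₀).2 (hmaxcrit' z₀ hD₀ hξ₀')
  -- the chart of the augmented critical set
  have hM₀ : (θ₀, ξ₀) ∈ augmentedCritical Θ Ξ f := by
    have h : σ z₀ ∈ augmentedCritical Θ Ξ f := ⟨(hσmem z₀ hD₀).1, (hσmem z₀ hD₀).2, hcrit₀⟩
    rwa [hσ₀] at h
  obtain ⟨X, Q, hX, hQdim, hXsrc, hMQ⟩ := hMB.2 _ hM₀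
  obtain ⟨pQ, hpQ⟩ := Submodule.ClosedComplemented.of_finiteDimensional Q
  let q₀ : Q := ⟨X (θ₀, ξ₀), (hMQ _ hXsrc).1 hM₀⟩
  have hXtgt : (q₀ : E × F) ∈ X.target := X.map_source hXsrc
  have hXq₀ : X.symm q₀ = (θ₀, ξ₀) := X.left_inv hXsrc
  let ψ : Q → V × W := fun q => τ (X.symm q)
  let lam : V × W → Q := fun z => pQ (X (σ z))
  have hXs : ContDiffAt ℝ ∞ (fun q : Q => X.symm q) q₀ :=
    (hX.contDiffAt_symm hXtgt).comp q₀ Q.subtypeL.contDiff.contDiffAt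
  have hXst : Tendsto (fun q : Q => X.symm q) (𝓝 q₀) (𝓝 (θ₀, ξ₀)) := by
    simpa [ContinuousAt, hXq₀] using hXs.continuousAt
  have hψ : ContDiffAt ℝ 1 ψ q₀ :=
    ContDiffAt.of_le (ContDiffAt.comp q₀ (by rw [hXq₀]; exact hτ _ hO₀) hXs)
      (WithTop.coe_le_coe.2 le_top)
  have hlam : ContDiffAt ℝ 1 lam z₀ :=
    ContDiffAt.of_le (pQ.contDiff.contDiffAt.comp z₀
      (ContDiffAt.comp (g := X) z₀ (by rw [hσ₀]; exact hX.contDiffAt hXsrc) (hσ z₀ hD₀)))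
      (WithTop.coe_le_coe.2 le_top)
  have hψ₀ : ψ q₀ = z₀ := by simp only [ψ, hXq₀, hz₀]
  have hlam₀ : lam z₀ = q₀ := by
    simp only [lam, hσ₀]
    exact hpQ q₀
  have hqnear : ∀ᶠ q : Q in 𝓝 q₀, (q : E × F) ∈ X.target ∧ X.symm q ∈ O :=
    (continuousAt_subtype_val.eventually (X.open_target.mem_nhds hXtgt)).and
      (hXst.eventually (hOopen.mem_nhds hO₀))
  have hqM : ∀ q : Q, (q : E × F) ∈ X.target → X.symm q ∈ augmentedCritical Θ Ξ f := fun q hq => by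
    rw [hMQ _ (X.map_target hq), X.right_inv hq]; exact q.2
  have hMsub : ∀ y ∈ augmentedCritical Θ Ξ f, y ∈ Θ ×ˢ Ξ := fun y hy => ⟨hy.1, hy.2.1⟩
  have hleft : ∀ᶠ q in 𝓝 q₀, lam (ψ q) = q := by
    filter_upwards [hqnear] with q hq
    change pQ (X (σ (τ (X.symm q)))) = q
    rw [hστ _ hq.2 (hMsub _ (hqM q hq.1)), X.right_inv hq.1]
    exact hpQ q
  have hcrit : ∀ᶠ q in 𝓝 q₀, IsFiberCritical g (ψ q) := by
    filter_upwards [hqnear] with q hq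
    have hy := hqM q hq.1
    refine (hcritiff _ (hτD _ hq.2 (hMsub _ hy))).1 ?_
    have h1 := hστ _ hq.2 (hMsub _ hy)
    have h2 : Ψ.symm (ψ q).1 = (X.symm (q : E × F)).1 := congrArg Prod.fst h1
    have h3 : Φ.symm (ψ q).2 = (X.symm (q : E × F)).2 := congrArg Prod.snd h1
    rw [h2, h3]
    exact hy.2.2
  have hright : ∀ᶠ z in 𝓝 z₀, IsFiberCritical g z → ψ (lam z) = z := by
    filter_upwards [hDn, hσt.eventually (X.open_source.mem_nhds hXsrc)] with z hz hzX hzc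
    have hzM : σ z ∈ augmentedCritical Θ Ξ f :=
      ⟨(hσmem z hz).1, (hσmem z hz).2, (hcritiff z hz).2 hzc⟩
    have h1 : (pQ (X (σ z)) : E × F) = X (σ z) :=
      congrArg Subtype.val (hpQ ⟨X (σ z), (hMQ _ hzX).1 hzM⟩)
    change τ (X.symm (pQ (X (σ z)) : E × F)) = z
    rw [h1, X.left_inv hzX, hτσ z hz]
  have hdim : Module.finrank ℝ V +
      Module.finrank ℝ (LinearMap.ker (fiberHess g z₀).toLinearMap) ≤ Module.finrank ℝ Q := by
    rw [hVdim, hQdim]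
    refine Nat.add_le_add_left ?_ k
    have h1 := finrank_ker_le_finrank_ker_riemHess hΦ hΞW hD₀.2
      (h := f (Ψ.symm z₀.1))
      (G := fun x => (fderiv ℝ g (z₀.1, x)).comp (ContinuousLinearMap.inr ℝ V W))
      (H := fiberHess g z₀) hcrit₀ (by
        have hnear : ∀ᶠ x : W in 𝓝 z₀.2, (x : F) ∈ Φ.target :=
          continuousAt_subtype_val.eventually (Φ.open_target.mem_nhds hD₀.2)
        filter_upwards [hnear] with x hx w
        exact hgder (z₀.1, x) ⟨hD₀.1, hx⟩ w)
      (hasFDerivAt_fderiv_fiber (hgC z₀ hD₀))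
    have h2 : Ψ.symm z₀.1 = θ₀ := congrArg Prod.fst hσ₀
    have h3 : Φ.symm z₀.2 = ξ₀ := congrArg Prod.snd hσ₀
    rw [h2, h3] at h1
    exact h1
  -- transfer from the chart
  obtain ⟨C, U₀, hU₀, hLip⟩ : ∃ C, ∃ U₀ ∈ 𝓝 (z₀.2 : F), LipschitzOnWith C Φ.symm U₀ :=
    ((hΦ.contDiffAt_symm hD₀.2).of_le (WithTop.coe_le_coe.2 le_top)).exists_lipschitzOnWith
  have hU : {x : W | (x : F) ∈ U₀ ∩ Φ.target} ∈ 𝓝 z₀.2 :=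
    continuousAt_subtype_val.eventually (inter_mem hU₀ (Φ.open_target.mem_nhds hD₀.2))
  obtain ⟨c, hc, hgrow⟩ := exists_quadratic_growth_of_fiberCritical (hgC z₀ hD₀) hmax₀ hψ hlam
    hψ₀ hlam₀ hleft hcrit hright hdim hU
  -- `C` is a Lipschitz constant of `Φ.symm`, converting chart distances to ambient ones; adding `1`
  -- avoids dividing by zero.
  refine ⟨c / ((C : ℝ) + 1) ^ 2, by positivity, ?_⟩
  have ht1 : Tendsto (fun y : E × F × F => (y.1, y.2.1)) (𝓝 (θ₀, ξ₀, ξ₀)) (𝓝 (θ₀, ξ₀)) :=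
    Continuous.tendsto (by fun_prop) _
  have ht2 : Tendsto (fun y : E × F × F => (y.1, y.2.2)) (𝓝 (θ₀, ξ₀, ξ₀)) (𝓝 (θ₀, ξ₀)) :=
    Continuous.tendsto (by fun_prop) _
  have ht3 : Tendsto (fun y : E × F × F => ((τ (y.1, y.2.1)).1, (τ (y.1, y.2.1)).2,
      (τ (y.1, y.2.2)).2)) (𝓝 (θ₀, ξ₀, ξ₀)) (𝓝 (z₀.1, z₀.2, z₀.2)) :=
    (continuousAt_fst.tendsto.comp (hτt.comp ht1)).prodMk_nhds
      ((continuousAt_snd.tendsto.comp (hτt.comp ht1)).prodMk_nhds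
        (continuousAt_snd.tendsto.comp (hτt.comp ht2)))
  have hOn : ∀ᶠ y in 𝓝 (θ₀, ξ₀), y ∈ O := hOopen.mem_nhds hO₀
  filter_upwards [ht1.eventually hOn, ht2.eventually hOn, ht3.eventually hgrow,
    (continuousAt_snd.tendsto.comp (hτt.comp ht1)).eventually hU]
  rintro ⟨θ, ξ, ξ'⟩ hO1 hO2 hgr hxU hθ hξ hξ'
  have hD1 := hτD _ hO1 ⟨hθ, hξ⟩
  have hD2 := hτD _ hO2 ⟨hθ, hξ'.1⟩
  have hs1 : σ (τ (θ, ξ)) = (θ, ξ) := hστ _ hO1 ⟨hθ, hξ⟩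
  have hs2 : σ (τ (θ, ξ')) = (θ, ξ') := hστ _ hO2 ⟨hθ, hξ'.1⟩
  have e1 : Ψ.symm (τ (θ, ξ)).1 = θ := congrArg Prod.fst hs1
  have e2 : Φ.symm (τ (θ, ξ)).2 = ξ := congrArg Prod.snd hs1
  have e3 : Φ.symm (τ (θ, ξ')).2 = ξ' := congrArg Prod.snd hs2
  obtain ⟨ζ, hζU, hζ1, hζ2⟩ := hgr (by
    refine hmaxcrit' (τ (θ, ξ')) hD2 ?_
    have h1 : Ψ.symm (τ (θ, ξ')).1 = θ := congrArg Prod.fst hs2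
    rw [h1, e3]
    exact hξ')
  have hgval : ∀ x : W, g ((τ (θ, ξ)).1, x) = f θ (Φ.symm x) := fun x => by
    change f (Ψ.symm (τ (θ, ξ)).1) (Φ.symm x) = _
    rw [e1]
  simp only [hgval, e2, e3] at hζ1 hζ2
  have hζΞ : Φ.symm ζ ∈ Ξ := (hσmem ((τ (θ, ξ)).1, ζ) ⟨hD1.1, hζU.2⟩).2
  -- The point `Φ.symm ζ` is a maximizer because `f θ` takes there the same value as at the
  -- maximizer `ξ'`.
  refine ⟨Φ.symm ζ, ⟨hζΞ, fun x hx => ?_⟩, ?_⟩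
  · change f θ x ≤ f θ (Φ.symm ζ)
    rw [hζ1]
    exact hξ'.2 hx
  · refine le_trans ?_ hζ2
    have h1 : ‖ξ - Φ.symm ζ‖ ≤ C * ‖(τ (θ, ξ)).2 - ζ‖ := by
      have h2 : dist (Φ.symm (τ (θ, ξ)).2) (Φ.symm ζ) ≤ C * dist ((τ (θ, ξ)).2 : F) ζ :=
        hLip.dist_le_mul _ hxU.1 _ hζU.1
      rwa [dist_eq_norm, dist_eq_norm, e2] at h2
    have h2 : ‖ξ - Φ.symm ζ‖ ≤ ((C : ℝ) + 1) * ‖(τ (θ, ξ)).2 - ζ‖ :=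
      h1.trans (by gcongr; linarith)
    change c / ((C : ℝ) + 1) ^ 2 * ‖ξ - Φ.symm ζ‖ ^ 2 ≤ c * ‖(τ (θ, ξ)).2 - ζ‖ ^ 2
    calc c / ((C : ℝ) + 1) ^ 2 * ‖ξ - Φ.symm ζ‖ ^ 2
        ≤ c / ((C : ℝ) + 1) ^ 2 * (((C : ℝ) + 1) * ‖(τ (θ, ξ)).2 - ζ‖) ^ 2 := by gcongr
      _ = c * ‖(τ (θ, ξ)).2 - ζ‖ ^ 2 := by field_simp

end Growth

/-- A family of local bounds with positive constants on a compact set has a common constant. -/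
theorem exists_pos_eventually_nhdsSet {X : Type*} [TopologicalSpace X] {K : Set X}
    (hK : IsCompact K) {p : ℝ → X → Prop} (hmono : ∀ c c' x, 0 < c' → c' ≤ c → p c x → p c' x)
    (hloc : ∀ x ∈ K, ∃ c > 0, ∀ᶠ y in 𝓝 x, p c y) : ∃ c > 0, ∀ᶠ y in 𝓝ˢ K, p c y := by
  refine hK.induction_on (p := fun s => ∃ c > 0, ∀ᶠ y in 𝓝ˢ s, p c y) ?_ ?_ ?_ ?_
  · exact ⟨1, one_pos, by simp⟩
  · rintro s t hst ⟨c, hc, h⟩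
    exact ⟨c, hc, h.filter_mono (nhdsSet_mono hst)⟩
  · rintro s t ⟨c, hc, hs⟩ ⟨c', hc', ht⟩
    refine ⟨min c c', lt_min hc hc', ?_⟩
    rw [nhdsSet_union, eventually_sup]
    exact ⟨hs.mono fun x => hmono _ _ x (lt_min hc hc') (min_le_left _ _),
      ht.mono fun x => hmono _ _ x (lt_min hc hc') (min_le_right _ _)⟩
  · intro x hx
    obtain ⟨c, hc, h⟩ := hloc x hx
    obtain ⟨t, hsub, htopen, hxt⟩ := eventually_nhds_iff.1 h
    exact ⟨t, mem_nhdsWithin_of_mem_nhds (htopen.mem_nhds hxt), c, hc,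
      by rw [htopen.nhdsSet_eq]; exact hsub⟩

end MorseBott

/-! ### Uniform constants by compactness. -/

theorem mainTheorem5 (p n k d : ℕ)
    (Θ : Set (EuclideanSpace ℝ (Fin p))) (Ξ : Set (EuclideanSpace ℝ (Fin n)))
    (f : EuclideanSpace ℝ (Fin p) → EuclideanSpace ℝ (Fin n) → ℝ)
    (hΘ_compact : IsCompact Θ) (hΘ_conn : IsConnected Θ)
    (hΘ : MorseBott.IsSubmanifold Θ k)
    (hΞ_compact : IsCompact Ξ) (hΞ_conn : IsConnected Ξ)
    (hΞ : MorseBott.IsSubmanifoldWithBoundary Ξ d)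
    -- `f` is `C³` on the product manifold
    (hf : ContDiffOn ℝ 3 (Function.uncurry f) (Θ ×ˢ Ξ))
    (hMB : MorseBott.IsParametricMorseBott Θ k Ξ d f)
    -- maximizers avoid the boundary (no condition when `∂Ξ = ∅`)
    (hint : ∀ θ ∈ Θ, MorseBott.argmaxOn (f θ) Ξ ⊆ Ξ \ MorseBott.manifoldBoundary Ξ d)
    (hmargin : MorseBott.UniformMargin (f '' Θ) Ξ) :
    ∃ μ > 0, ∃ L > 0, ∀ θ ∈ Θ, ∀ ξ ∈ Ξ, ∀ ξ' ∈ MorseBott.argmaxOn (f θ) Ξ,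
      (∀ ζ ∈ MorseBott.argmaxOn (f θ) Ξ, ‖ξ - ξ'‖ ≤ ‖ξ - ζ‖) →
        f θ ξ' ≥ f θ ξ + μ / 2 * ‖ξ - ξ'‖ ^ 2 - L / 6 * ‖ξ - ξ'‖ ^ 3 := by
  have hcont := hf.continuousOn
  -- the diagonal copies of the maximizers
  let K : Set (EuclideanSpace ℝ (Fin p) × EuclideanSpace ℝ (Fin n) × EuclideanSpace ℝ (Fin n)) :=
    {y | y.1 ∈ Θ ∧ y.2.1 = y.2.2 ∧ y.2.2 ∈ MorseBott.argmaxOn (f y.1) Ξ}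
  have hK : IsCompact K := by
    let A : Set (EuclideanSpace ℝ (Fin p) × EuclideanSpace ℝ (Fin n)) :=
      {z | z ∈ Θ ×ˢ Ξ ∧ ∀ ζ ∈ Ξ, f z.1 ζ ≤ f z.1 z.2}
    have hA : IsCompact A := by
      refine (hΘ_compact.prod hΞ_compact).of_isClosed_subset ?_ fun z hz => hz.1
      have hcl : IsClosed (Θ ×ˢ Ξ) := (hΘ_compact.prod hΞ_compact).isClosed
      have : A = (Θ ×ˢ Ξ) ∩ ⋂ ζ ∈ Ξ, {z ∈ Θ ×ˢ Ξ | f z.1 ζ ≤ f z.1 z.2} := by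
        ext z
        simp only [A, Set.mem_ofPred_eq, Set.mem_inter_iff, Set.mem_iInter]
        exact ⟨fun h => ⟨h.1, fun ζ hζ => ⟨h.1, h.2 ζ hζ⟩⟩,
          fun h => ⟨h.1, fun ζ hζ => (h.2 ζ hζ).2⟩⟩
      rw [this]
      refine hcl.inter (isClosed_biInter fun ζ hζ => ?_)
      refine hcl.isClosed_le ?_ hcont
      exact hcont.comp (f := fun z : EuclideanSpace ℝ (Fin p) × EuclideanSpace ℝ (Fin n) =>
        (z.1, ζ)) (by fun_prop) fun z hz => ⟨hz.1, hζ⟩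
    have : K = (fun z : EuclideanSpace ℝ (Fin p) × EuclideanSpace ℝ (Fin n) =>
        (z.1, z.2, z.2)) '' A := by
      ext ⟨θ, ξ, ξ'⟩
      constructor
      · rintro ⟨h1, h2, h3⟩
        simp only at h2
        subst h2
        exact ⟨(θ, ξ), ⟨⟨h1, h3.1⟩, fun ζ hζ => h3.2 hζ⟩, rfl⟩
      · rintro ⟨z, ⟨hz, hmax⟩, he⟩
        obtain ⟨rfl, rfl, rfl⟩ : z.1 = θ ∧ z.2 = ξ ∧ z.2 = ξ' := by simpa using he
        exact ⟨hz.1, rfl, hz.2, fun ζ hζ => hmax ζ hζ⟩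
    rw [this]
    exact hA.image (by fun_prop)
  obtain ⟨c, hc, hev⟩ := MorseBott.exists_pos_eventually_nhdsSet hK
    (p := fun c y => y.1 ∈ Θ → y.2.1 ∈ Ξ → y.2.2 ∈ MorseBott.argmaxOn (f y.1) Ξ →
      ∃ ζ ∈ MorseBott.argmaxOn (f y.1) Ξ, c * ‖y.2.1 - ζ‖ ^ 2 ≤ f y.1 ζ - f y.1 y.2.1)
    (fun c c' y _ hcc h h1 h2 h3 => by
      obtain ⟨ζ, hζ, hle⟩ := h h1 h2 h3
      exact ⟨ζ, hζ, (by gcongr : c' * ‖y.2.1 - ζ‖ ^ 2 ≤ c * ‖y.2.1 - ζ‖ ^ 2).trans hle⟩)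
    (by
      rintro ⟨θ, ξ, ξ'⟩ ⟨hθ, hξ, hmax⟩
      simp only at hθ hξ hmax
      subst hξ
      -- A half-slice chart would put the maximizer on the boundary.
      have hslice : MorseBott.HasSliceChart Ξ d ξ :=
        (hΞ ξ hmax.1).resolve_right fun h => (hint θ hθ hmax).2 ⟨hmax.1, h⟩
      exact MorseBott.exists_local_quadratic_growth (hf.of_le (by norm_num)) hMB hθ hmax
        (hΘ θ hθ) hslice)
  obtain ⟨O, hOopen, hKO, hO⟩ := mem_nhdsSet_iff_exists.1 hev
  obtain ⟨r, hr, hthick⟩ := hK.exists_thickening_subset_open hOopen hKO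
  -- `μ / 2 = c`, and `L / 6 = c / r` makes the cubic term `c s² (s / r)`, at least `c s²` once `s ≥
  -- r`; there maximality alone suffices.
  refine ⟨2 * c, by positivity, 6 * c / r, by positivity, fun θ hθ ξ hξ ξ' hξ' hproj => ?_⟩
  set s := ‖ξ - ξ'‖ with hs
  have hs0 : 0 ≤ s := norm_nonneg _
  rcases lt_or_ge s r with hlt | hge
  · have hmem : (θ, ξ, ξ') ∈ O := by
      refine hthick (Metric.mem_thickening_iff.2 ⟨(θ, ξ', ξ'), ⟨hθ, rfl, hξ'⟩, ?_⟩)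
      simpa [Prod.dist_eq, dist_eq_norm, hr] using hlt
    obtain ⟨ζ, hζ, hle⟩ := hO hmem hθ hξ hξ'
    -- The maximizer `ζ` need not be `ξ'`, but both have the same value and `ξ'` is at least as
    -- close to `ξ`.
    have h1 : f θ ζ ≤ f θ ξ' := hξ'.2 hζ.1
    have h2 : c * s ^ 2 ≤ c * ‖ξ - ζ‖ ^ 2 := by
      have := hproj ζ hζ
      gcongr
    have h3 : 0 ≤ 6 * c / r / 6 * s ^ 3 := by positivity
    simp only at hle
    linarith
  · have h1 : f θ ξ ≤ f θ ξ' := hξ'.2 hξ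
    have h2 : c * s ^ 2 ≤ 6 * c / r / 6 * s ^ 3 := by
      have : 6 * c / r / 6 * s ^ 3 = c * s ^ 2 * (s / r) := by field_simp
      rw [this]
      exact le_mul_of_one_le_right (by positivity) ((one_le_div hr).2 hge)
    linarith
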